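/- Let $\mathcal P$ be a set of pairwise distinct prime numbers with $2\notin\mathcal P$, and let $X=\prod_{p\in\mathcal P}X_p$ (with the product topology), where each $X_p$ is either a finite cyclic $p$-group $\mathbb Z(p^{k_p})$ with the discrete topology or the compact group $\mathbb Z_p$ of $p$-adic integers. Let $Y$ be the character group of $X$, and let $\alpha$ be a topological automorphism of $X$. Let $\xi_1,\xi_2$ be independent random variables with values in $X$ and distributions $\mu_1,\mu_2$. Assume that the conditional distribution of $L_2=\xi_1+\alpha\xi_2$ given $L_1=\xi_1+\xi_2$ is symmetric, and that the characteristic functions $\hat\mu_j(y)=\int_X (x,y)\,d\mu_j(x)$, $y\in Y$, $j=1,2$, do not vanish at any point of $Y$. Then there is a probability distribution $\lambda$ on $X$ supported in $\mathrm{Ker}(I+\alpha)=\{x\in X: x+\alpha x=0\}$ such that both $\mu_1$ and $\mu_2$ are shifts of $\lambda$, i.e. there are $x_1,x_2\in X$ such that, for $j=1,2$, $\mu_j(B)=\lambda(B-x_j)$ for every Borel set $B\subset X$. -/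

import Mathlib

open MeasureTheory ProbabilityTheory

/-- `A` is, as a topological group, either the finite cyclic `p`-group `ℤ/pᵏ` (discrete), for some
natural number `k`, or the group of `p`-adic integers. -/
def IsPrimaryFactor (p : ℕ) [Fact p.Prime] (A : Type*) [AddCommGroup A] [TopologicalSpace A] :
    Prop :=
  (∃ k : ℕ, Nonempty (A ≃ₜ+ ZMod (p ^ k))) ∨ Nonempty (A ≃ₜ+ ℤ_[p])

instance factPrimeOfPrimes (p : Nat.Primes) : Fact (p : ℕ).Prime := ⟨p.2⟩

/-- The character group of an additive topological group `X`: all continuous homomorphisms from `X`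
to the circle group. -/
abbrev CharacterGroup (X : Type*) [AddCommGroup X] [TopologicalSpace X] : Type _ :=
  PontryaginDual (Multiplicative X)

/-- The characteristic function `y ↦ ∫ (x, y) dμ(x)` of a measure `μ` on `X`. -/
noncomputable def characteristicFn {X : Type*} [AddCommGroup X] [TopologicalSpace X]
    [MeasurableSpace X] (μ : Measure X) (y : CharacterGroup X) : ℂ :=
  ∫ x, ((y (Multiplicative.ofAdd x) : Circle) : ℂ) ∂μ

/-- The conditional distribution of `η` given `ξ` is symmetric: there is a regular conditional
distribution `κ` of `η` given `ξ` (a Markov kernel that disintegrates the joint law of `(ξ, η)` over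
the law of `ξ`) such that `κ x` is invariant under `z ↦ -z` for almost all values `x` of `ξ`. -/
def HasSymmetricCondDistrib {Ω X : Type*} [MeasurableSpace Ω] [MeasurableSpace X] [Neg X]
    (η ξ : Ω → X) (P : Measure Ω) : Prop :=
  ∃ κ : Kernel X X, IsMarkovKernel κ ∧
    P.map (fun ω => (ξ ω, η ω)) = (P.map ξ) ⊗ₘ κ ∧
    ∀ᵐ x ∂(P.map ξ), (κ x).map (fun z => -z) = κ x

/-!
Let `L₁ = ξ₁ + ξ₂` and `L₂ = ξ₁ + α ξ₂`. The symmetry of the conditional distribution means that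
`(L₁, L₂)` and `(L₁, -L₂)` have the same law. On the character group `Y`, with `β` the adjoint of
`α`, this is the Heyde functional equation `μ̂₁(u + v) μ̂₂(u + β v) = μ̂₁(u - v) μ̂₂(u - β v)`. As
the characteristic functions have no zeros, `φ = -log |μ̂₁|` and `ψ = -log |μ̂₂|` are nonnegative
solutions of the additive form of this equation.

Three differencing steps eliminate `φ` and show that third differences of `ψ` with step in `H =
(β² - 1) Y` vanish (`third_difference_eq_zero_of_heyde_equation`). Since `2 ∉ S`, every character
of `X` has odd finite order (`exists_odd_pow_eq_one`). So `ψ` is, along each cyclic subgroup of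
`H`, a quadratic polynomial that is periodic, and it vanishes on `H`. Where `ψ` vanishes its
argument is a period of `ψ`, by the equality case of `|∫ f| ≤ ∫ |f|`. On `(1 + β) Y` the map `β`
is the identity modulo `H`, so putting `v = u` gives `φ + ψ = 0` there: both characteristic
functions have modulus one on `(1 + β) Y` (`eq_zero_of_heyde_equation`). Hence every character in
`(1 + β) Y` is constant on the support of each law, and because characters separate points
(`exists_character_ne_one`), each support lies in a coset of the kernel of `1 + α`
(`add_map_sub_eq_zero_of_mem_support`).

On that kernel `α = -1`. The equality of the laws of `L₁ + L₂` and `L₁ - L₂` therefore says that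
`2 ξ₁ + c` and `2 ξ₂ - c` have the same law for some constant `c`, that is, `2 (ξ₁ + c)` and `2
ξ₂` do. Doubling is injective on `X`, so `ξ₂` is distributed as `ξ₁ + c`
(`exists_common_shift_of_symmetric_condDistrib`).
-/

/-! ### The functional equation on an odd torsion group -/

theorem eq_of_third_difference_eq_zero_of_periodic {a : ℕ → ℝ}
    (h : ∀ n, a (n + 3) - 3 * a (n + 2) + 3 * a (n + 1) - a n = 0) {N : ℕ} (hN : 0 < N)
    (hper : ∀ n, a (n + N) = a n) : a 1 = a 0 := by
  have h2 : ∀ n, a (n + 2) - 2 * a (n + 1) + a n = a 2 - 2 * a 1 + a 0 := by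
    intro n
    induction n with
    | zero => simp
    | succ n ih =>
      have := h n
      rw [show n + 1 + 2 = n + 3 by ring, show n + 1 + 1 = n + 2 by ring]
      linarith
  have h1 : ∀ n : ℕ, a (n + 1) - a n = a 1 - a 0 + n * (a 2 - 2 * a 1 + a 0) := by
    intro n
    induction n with
    | zero => simp
    | succ n ih =>
      have := h2 n
      rw [show n + 1 + 1 = n + 2 by ring]
      push_cast
      linarith
  have hN' : (N : ℝ) ≠ 0 := by positivity
  have hc : a 2 - 2 * a 1 + a 0 = 0 := by
    have e := h1 N
    have e0 := hper 0
    have e1 := hper 1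
    rw [zero_add] at e0
    rw [add_comm] at e1
    have : (N : ℝ) * (a 2 - 2 * a 1 + a 0) = 0 := by linarith
    exact (mul_eq_zero.mp this).resolve_left hN'
  have h0 : ∀ n : ℕ, a n = a 0 + n * (a 1 - a 0) := by
    intro n
    induction n with
    | zero => simp
    | succ n ih =>
      have := h1 n
      rw [hc] at this
      push_cast
      linarith
  have e := h0 N
  have e0 := hper 0
  rw [zero_add] at e0
  have : (N : ℝ) * (a 1 - a 0) = 0 := by linarith
  linarith [(mul_eq_zero.mp this).resolve_left hN']

/-- Along the multiples of `h`, `φ` is a polynomial of degree at most two that is periodic, hence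
constant. -/
theorem eq_zero_of_third_difference_eq_zero {Y : Type*} [AddCommGroup Y] {φ : Y → ℝ}
    (h0 : φ 0 = 0) {h : Y} {N : ℕ} (hN : 0 < N) (hNh : N • h = 0)
    (hdiff : ∀ y, φ (y + h + h + h) - 3 * φ (y + h + h) + 3 * φ (y + h) - φ y = 0) :
    φ h = 0 := by
  have := eq_of_third_difference_eq_zero_of_periodic (a := fun n => φ (n • h)) (fun n => by
    have := hdiff (n • h)
    simp only [add_smul, one_smul, ofNat_smul_eq_nsmul]
    rw [show n • h + 3 • h = n • h + h + h + h by abel,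
      show n • h + 2 • h = n • h + h + h by abel]
    exact this) hN (fun n => by simp [add_smul, hNh])
  simpa [h0] using this

theorem exists_add_self_eq_of_odd_torsion {Y : Type*} [AddCommGroup Y]
    (htor : ∀ y : Y, ∃ N : ℕ, Odd N ∧ N • y = 0) (y : Y) : ∃ z : Y, y = z + z := by
  obtain ⟨N, ⟨m, rfl⟩, hN⟩ := htor y
  refine ⟨(m + 1) • y, ?_⟩
  calc y = y + (2 * m + 1) • y := by rw [hN, add_zero]
    _ = (m + 1) • y + (m + 1) • y := by
      simp only [add_smul, mul_smul, two_smul, one_smul]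
      abel

section FunctionalEquation

variable {Y : Type*} [AddCommGroup Y] {β : Y →+ Y} {φ ψ : Y → ℝ}

/-- Third differences of `ψ` with step in `(β² - 1) Y` vanish: the shifts of `(u, v)` by
`(β k, k)`, `(l, l)` and `(m, -m)` leave `u - β v`, `u - v` and `u + v` fixed, respectively, so
that differencing along all three removes every term except the one with `ψ (u + β v)`. -/
theorem third_difference_eq_zero_of_heyde_equation
    (heq : ∀ u v, φ (u + v) + ψ (u + β v) = φ (u - v) + ψ (u - β v)) (z : Y) {h : Y}
    (hh : h = β (β (β z + β z)) - (β z + β z)) (y : Y) :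
    ψ (y + h + h + h) - 3 * ψ (y + h + h) + 3 * ψ (y + h) - ψ y = 0 := by
  obtain ⟨k, hk⟩ : ∃ k, k = β (β z) - z := ⟨_, rfl⟩
  obtain ⟨l, hl⟩ : ∃ l, l = β (β z + β z) - (β z + β z) := ⟨_, rfl⟩
  obtain ⟨m, hm⟩ : ∃ m, m = -(β (β z + β z) + (β z + β z)) := ⟨_, rfl⟩
  have hk' : β k + β k = h := by subst hk hh; simp only [map_add, map_sub]; abel
  have hl' : l + β l = h := by subst hl hh; simp only [map_add, map_sub]; abel
  have hm' : m - β m = h := by subst hm hh; simp only [map_add, map_neg]; abel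
  have key : ∀ U V P Q R S, P = U + V → Q = U + β V → R = U - V → S = U - β V →
      φ P + ψ Q = φ R + ψ S := by
    rintro U V _ _ _ _ rfl rfl rfl rfl
    exact heq U V
  clear hk hl hm hh
  have e000 := key y 0 y y y y (by simp) (by simp) (by simp) (by simp)
  have e100 := key (y + β k) k (y + k + β k) (y + h) (y + β k - k) y
    (by abel) (by rw [← hk']; abel) (by abel) (by abel)
  have e010 := key (y + l) l (y + l + l) (y + h) y (y + l - β l)
    (by abel) (by rw [← hl']; abel) (by abel) (by abel)
  have e001 := key (y + m) (-m) y (y + h) (y + m + m) (y + m + β m)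
    (by abel) (by rw [← hm', map_neg]; abel) (by abel) (by rw [map_neg]; abel)
  have e110 := key (y + β k + l) (k + l) (y + k + β k + l + l) (y + h + h) (y + β k - k)
    (y + l - β l) (by abel) (by nth_rw 1 [← hk']; rw [← hl', map_add]; abel) (by abel)
    (by rw [map_add]; abel)
  have e101 := key (y + β k + m) (k - m) (y + k + β k) (y + h + h) (y + β k - k + m + m)
    (y + m + β m) (by abel) (by nth_rw 1 [← hk']; rw [← hm', map_sub]; abel) (by abel)
    (by rw [map_sub]; abel)
  have e011 := key (y + l + m) (l - m) (y + l + l) (y + h + h) (y + m + m)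
    (y + l - β l + m + β m) (by abel) (by nth_rw 1 [← hl']; rw [← hm', map_sub]; abel)
    (by abel) (by rw [map_sub]; abel)
  have e111 := key (y + β k + l + m) (k + l - m) (y + k + β k + l + l) (y + h + h + h)
    (y + β k - k + m + m) (y + l - β l + m + β m) (by abel)
    (by nth_rw 1 [← hk']; nth_rw 1 [← hl']; rw [← hm', map_sub, map_add]; abel)
    (by abel) (by rw [map_sub, map_add]; abel)
  linarith

/-- Nonnegative solutions of the Heyde functional equation on an odd torsion group vanish on
`(1 + β) Y`. Having degree at most two, `ψ` vanishes on `H = (β² - 1) Y`, hence is `H`-invariant.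
Since `β` is the identity on `(1 + β) Y` modulo `H`, the equation with `v = u` gives `φ + ψ = 0`
there. -/
theorem eq_zero_of_heyde_equation (htor : ∀ y : Y, ∃ N : ℕ, Odd N ∧ N • y = 0)
    (hβ : Function.Surjective β) (hφ0 : φ 0 = 0) (hψ0 : ψ 0 = 0)
    (hφ : ∀ y, 0 ≤ φ y) (hψ : ∀ y, 0 ≤ ψ y)
    (hψinv : ∀ y h, ψ h = 0 → ψ (y + h) = ψ y)
    (heq : ∀ u v, φ (u + v) + ψ (u + β v) = φ (u - v) + ψ (u - β v)) (y : Y) :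
    φ (y + β y) = 0 ∧ ψ (y + β y) = 0 := by
  have hψH : ∀ w, ψ (β (β w) - w) = 0 := by
    intro w
    obtain ⟨w', rfl⟩ := exists_add_self_eq_of_odd_torsion htor w
    obtain ⟨z, rfl⟩ := hβ w'
    obtain ⟨N, hN, hN'⟩ := htor (β (β (β z + β z)) - (β z + β z))
    exact eq_zero_of_third_difference_eq_zero hψ0 hN.pos hN'
      (third_difference_eq_zero_of_heyde_equation heq z rfl)
  obtain ⟨w, rfl⟩ := exists_add_self_eq_of_odd_torsion htor y
  have e := heq (w + β w) (w + β w)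
  have e1 : w + β w + β (w + β w) = w + w + β (w + w) + (β (β w) - w) := by
    simp only [map_add]; abel
  have e2 : w + β w - β (w + β w) = β (β (-w)) - -w := by
    simp only [map_add, map_neg]; abel
  have e3 : w + β w + (w + β w) = w + w + β (w + w) := by
    simp only [map_add]; abel
  rw [e1, e2, hψH, hψinv _ _ (hψH w), sub_self, hφ0, e3] at e
  constructor <;> linarith [hφ (w + w + β (w + w)), hψ (w + w + β (w + w))]

end FunctionalEquation

/-! ### Characteristic functions -/

section CharacteristicFunction

variable {X : Type*} [AddCommGroup X] [TopologicalSpace X]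

theorem continuous_character (y : CharacterGroup X) :
    Continuous fun x : X => ((y (Multiplicative.ofAdd x) : Circle) : ℂ) :=
  continuous_subtype_val.comp ((map_continuous y).comp continuous_ofAdd)

theorem character_add (y : CharacterGroup X) (a b : X) :
    ((y (Multiplicative.ofAdd (a + b)) : Circle) : ℂ) =
      ((y (Multiplicative.ofAdd a) : Circle) : ℂ) *
        ((y (Multiplicative.ofAdd b) : Circle) : ℂ) := by
  rw [ofAdd_add, map_mul, Circle.coe_mul]

theorem character_neg (y : CharacterGroup X) (a : X) :
    ((y (Multiplicative.ofAdd (-a)) : Circle) : ℂ) =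
      ((y (Multiplicative.ofAdd a) : Circle) : ℂ)⁻¹ := by
  rw [ofAdd_neg, map_inv, Circle.coe_inv]

/-- The adjoint of a topological automorphism, acting on the (additively written) character group
by precomposition. -/
noncomputable def dualMap (α : X ≃ₜ+ X) :
    Additive (CharacterGroup X) →+ Additive (CharacterGroup X) :=
  MonoidHom.toAdditive (PontryaginDual.map
    (A := Multiplicative X) (B := Multiplicative X)
    { toFun := fun x => Multiplicative.ofAdd (α x.toAdd)
      map_one' := by simp
      map_mul' := fun _ _ => by simp
      continuous_toFun :=
        continuous_ofAdd.comp (α.continuous_toFun.comp continuous_toAdd) }).toMonoidHom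

theorem dualMap_surjective (α : X ≃ₜ+ X) : Function.Surjective (dualMap α) := by
  intro y
  refine ⟨dualMap α.symm y, ?_⟩
  apply Additive.toMul.injective
  refine PontryaginDual.ext fun x => ?_
  change y.toMul (Multiplicative.ofAdd (α.symm (α x.toAdd))) = _
  rw [α.symm_apply_apply]
  rfl

variable [MeasurableSpace X]

theorem characteristicFn_one (μ : Measure X) [IsProbabilityMeasure μ] :
    characteristicFn μ 1 = 1 := by
  simp [characteristicFn]

/-- Strict convexity of the disc: a characteristic function has modulus one at `y` only if `y` is
almost everywhere constant. -/
theorem ae_eq_characteristicFn_of_norm_eq_one {μ : Measure X} [IsProbabilityMeasure μ]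
    {y : CharacterGroup X} (h : ‖characteristicFn μ y‖ = 1) :
    ∀ᵐ x ∂μ, ((y (Multiplicative.ofAdd x) : Circle) : ℂ) = characteristicFn μ y := by
  rcases ae_eq_const_or_norm_integral_lt_of_norm_le_const (μ := μ) (C := 1)
    (f := fun x => ((y (Multiplicative.ofAdd x) : Circle) : ℂ))
    (.of_forall fun _ => (Circle.norm_coe _).le) with h' | h'
  · filter_upwards [h'] with x hx
    rw [hx, average_eq_integral]
    rfl
  · simp only [probReal_univ, one_mul] at h'
    exact absurd h h'.ne

theorem norm_characteristicFn_le_one (μ : Measure X) [IsProbabilityMeasure μ]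
    (y : CharacterGroup X) : ‖characteristicFn μ y‖ ≤ 1 := by
  rw [characteristicFn]
  simpa using norm_integral_le_of_norm_le_const (μ := μ) (C := 1)
    (f := fun x => ((y (Multiplicative.ofAdd x) : Circle) : ℂ))
    (.of_forall fun _ => (Circle.norm_coe _).le)

theorem norm_characteristicFn_mul_of_norm_eq_one {μ : Measure X} [IsProbabilityMeasure μ]
    (y : CharacterGroup X) {h : CharacterGroup X} (hh : ‖characteristicFn μ h‖ = 1) :
    ‖characteristicFn μ (y * h)‖ = ‖characteristicFn μ y‖ := by
  have : characteristicFn μ (y * h) = characteristicFn μ y * characteristicFn μ h := by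
    conv_lhs => unfold characteristicFn
    conv_rhs => enter [1]; unfold characteristicFn
    rw [← integral_mul_const]
    refine integral_congr_ae ?_
    filter_upwards [ae_eq_characteristicFn_of_norm_eq_one hh] with x hx
    rw [← hx]
    exact Circle.coe_mul _ _
  rw [this, norm_mul, hh, mul_one]

end CharacteristicFunction

/-! ### Symmetric conditional distributions -/

/-- If the conditional distribution of `η` given `ξ` is symmetric, then `(ξ, η)` and `(ξ, -η)` have
the same law. -/
theorem HasSymmetricCondDistrib.map_prodMk_neg {Ω X : Type*} [MeasurableSpace Ω]
    [MeasurableSpace X] [Neg X] [MeasurableNeg X] {η ξ : Ω → X} {P : Measure Ω}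
    [IsProbabilityMeasure P] (hη : Measurable η) (hξ : Measurable ξ)
    (h : HasSymmetricCondDistrib η ξ P) :
    P.map (fun ω => (ξ ω, -η ω)) = P.map (fun ω => (ξ ω, η ω)) := by
  obtain ⟨κ, hκ, hjoint, hsymm⟩ := h
  have : IsProbabilityMeasure (P.map ξ) := Measure.isProbabilityMeasure_map hξ.aemeasurable
  have hae : κ.map (fun z => -z) =ᵐ[P.map ξ] κ := by
    filter_upwards [hsymm] with x hx
    rw [Kernel.map_apply _ measurable_neg, hx]
  calc P.map (fun ω => (ξ ω, -η ω))
      = (P.map (fun ω => (ξ ω, η ω))).map (Prod.map id (fun z => -z)) := by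
        rw [Measure.map_map (by fun_prop) (by fun_prop)]
        rfl
    _ = P.map ξ ⊗ₘ κ.map (fun z => -z) := by
        rw [hjoint, Measure.compProd_map measurable_neg]
    _ = P.map (fun ω => (ξ ω, η ω)) := by
        rw [hjoint, Measure.compProd_congr hae]

section HeydeEquation

variable {X : Type*} [AddCommGroup X] [TopologicalSpace X] [MeasurableSpace X] [BorelSpace X]
  {Ω : Type*} [MeasurableSpace Ω] {P : Measure Ω} {ξ₁ ξ₂ : Ω → X}

theorem integral_character_mul_character (h₁ : Measurable ξ₁) (h₂ : Measurable ξ₂)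
    (hindep : IndepFun ξ₁ ξ₂ P) (y z : CharacterGroup X) :
    ∫ ω, ((y (Multiplicative.ofAdd (ξ₁ ω)) : Circle) : ℂ) *
      ((z (Multiplicative.ofAdd (ξ₂ ω)) : Circle) : ℂ) ∂P =
      characteristicFn (P.map ξ₁) y * characteristicFn (P.map ξ₂) z := by
  have hy := (continuous_character y).measurable
  have hz := (continuous_character z).measurable
  rw [characteristicFn, characteristicFn,
    integral_map h₁.aemeasurable hy.aestronglyMeasurable,
    integral_map h₂.aemeasurable hz.aestronglyMeasurable]
  exact (hindep.comp hy hz).integral_fun_mul_eq_mul_integral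
    (hy.comp h₁).aestronglyMeasurable (hz.comp h₂).aestronglyMeasurable

variable [IsTopologicalAddGroup X] [SecondCountableTopology X] [IsProbabilityMeasure P]

/-- Symmetry of the conditional distribution of `ξ₁ + α ξ₂` given `ξ₁ + ξ₂`, expressed by
characteristic functions. -/
theorem characteristicFn_heyde_equation (α : X ≃ₜ+ X) (h₁ : Measurable ξ₁) (h₂ : Measurable ξ₂)
    (hindep : IndepFun ξ₁ ξ₂ P)
    (hsymm : HasSymmetricCondDistrib (fun ω => ξ₁ ω + α (ξ₂ ω)) (fun ω => ξ₁ ω + ξ₂ ω) P)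
    (u v : Additive (CharacterGroup X)) :
    characteristicFn (P.map ξ₁) (u + v).toMul *
        characteristicFn (P.map ξ₂) (u + dualMap α v).toMul =
      characteristicFn (P.map ξ₁) (u - v).toMul *
        characteristicFn (P.map ξ₂) (u - dualMap α v).toMul := by
  have hα : Measurable α := α.continuous.measurable
  have hlaw : P.map (fun ω => (ξ₁ ω + ξ₂ ω, -(ξ₁ ω + α (ξ₂ ω)))) =
      P.map (fun ω => (ξ₁ ω + ξ₂ ω, ξ₁ ω + α (ξ₂ ω))) :=
    hsymm.map_prodMk_neg (h₁.add (hα.comp h₂)) (h₁.add h₂)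
  have hc : Measurable fun q : X × X => ((u.toMul (Multiplicative.ofAdd q.1) : Circle) : ℂ) *
      ((v.toMul (Multiplicative.ofAdd q.2) : Circle) : ℂ) :=
    ((continuous_character u.toMul).measurable.comp measurable_fst).mul
      ((continuous_character v.toMul).measurable.comp measurable_snd)
  have hint := congrArg (fun m : Measure (X × X) => ∫ q,
    ((u.toMul (Multiplicative.ofAdd q.1) : Circle) : ℂ) *
      ((v.toMul (Multiplicative.ofAdd q.2) : Circle) : ℂ) ∂m) hlaw
  beta_reduce at hint
  rw [integral_map (by fun_prop) hc.aestronglyMeasurable,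
    integral_map (by fun_prop) hc.aestronglyMeasurable] at hint
  rw [← integral_character_mul_character h₁ h₂ hindep,
    ← integral_character_mul_character h₁ h₂ hindep]
  refine Eq.trans (integral_congr_ae (.of_forall fun ω => ?_))
    (hint.symm.trans (integral_congr_ae (.of_forall fun ω => ?_)))
  · change (((u.toMul (Multiplicative.ofAdd (ξ₁ ω)) * v.toMul (Multiplicative.ofAdd (ξ₁ ω)) :
        Circle)) : ℂ) * ((u.toMul (Multiplicative.ofAdd (ξ₂ ω)) *
        v.toMul (Multiplicative.ofAdd (α (ξ₂ ω))) : Circle) : ℂ) = _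
    simp only [character_add, Circle.coe_mul]
    ring
  · change _ = (((u.toMul (Multiplicative.ofAdd (ξ₁ ω)) / v.toMul (Multiplicative.ofAdd (ξ₁ ω)) :
        Circle)) : ℂ) * ((u.toMul (Multiplicative.ofAdd (ξ₂ ω)) /
        v.toMul (Multiplicative.ofAdd (α (ξ₂ ω))) : Circle) : ℂ)
    simp only [character_add, character_neg, Circle.coe_mul, Circle.coe_inv, div_eq_mul_inv,
      mul_inv]
    ring

end HeydeEquation

/-! ### Concentration on a coset of the kernel and comparison of the two laws -/

section Heyde

variable {X : Type*} [AddCommGroup X] [TopologicalSpace X] [MeasurableSpace X]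

theorem add_map_sub_eq_zero_of_mem_support {α : X ≃ₜ+ X} {μ : Measure X} [IsProbabilityMeasure μ]
    (hsep : ∀ x : X, x ≠ 0 → ∃ y : CharacterGroup X, y (Multiplicative.ofAdd x) ≠ 1)
    (hμ : ∀ y : Additive (CharacterGroup X), ‖characteristicFn μ (y + dualMap α y).toMul‖ = 1)
    {s t : X} (hs : s ∈ μ.support) (ht : t ∈ μ.support) : s - t + α (s - t) = 0 := by
  by_contra hne
  obtain ⟨y, hy⟩ := hsep _ hne
  refine hy ?_
  have hconst : ∀ x ∈ μ.support, y (Multiplicative.ofAdd (x + α x)) =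
      (characteristicFn μ (Additive.ofMul y + dualMap α (Additive.ofMul y)).toMul) := by
    have hsub := Measure.support_subset_of_isClosed
      (isClosed_eq (continuous_character
        (Additive.ofMul y + dualMap α (Additive.ofMul y)).toMul) continuous_const)
      (ae_eq_characteristicFn_of_norm_eq_one (hμ (Additive.ofMul y)))
    intro x hx
    rw [← show _ = _ from hsub hx, character_add]
    exact (Circle.coe_mul _ _).symm
  have heq : y (Multiplicative.ofAdd (s + α s)) = y (Multiplicative.ofAdd (t + α t)) :=
    Circle.ext ((hconst s hs).trans (hconst t ht).symm)
  rw [show s - t + α (s - t) = s + α s - (t + α t) by rw [map_sub]; abel, ofAdd_sub, map_div, heq,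
    div_self']

variable [BorelSpace X]

/-- Heyde's theorem for a compact group without elements of order two whose characters separate
points and have odd finite order. -/
theorem exists_common_shift_of_symmetric_condDistrib [IsTopologicalAddGroup X] [CompactSpace X]
    [T2Space X] [SecondCountableTopology X]
    (hdouble : ∀ x : X, x + x = 0 → x = 0)
    (hsep : ∀ x : X, x ≠ 0 → ∃ y : CharacterGroup X, y (Multiplicative.ofAdd x) ≠ 1)
    (htor : ∀ y : CharacterGroup X, ∃ N : ℕ, Odd N ∧ y ^ N = 1) (α : X ≃ₜ+ X)
    {Ω : Type*} [MeasurableSpace Ω] {P : Measure Ω} [IsProbabilityMeasure P] {ξ₁ ξ₂ : Ω → X}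
    (h₁ : Measurable ξ₁) (h₂ : Measurable ξ₂) (hindep : IndepFun ξ₁ ξ₂ P)
    (hsymm : HasSymmetricCondDistrib (fun ω => ξ₁ ω + α (ξ₂ ω)) (fun ω => ξ₁ ω + ξ₂ ω) P)
    (hne₁ : ∀ y : CharacterGroup X, characteristicFn (P.map ξ₁) y ≠ 0)
    (hne₂ : ∀ y : CharacterGroup X, characteristicFn (P.map ξ₂) y ≠ 0) :
    ∃ ν : Measure X, IsProbabilityMeasure ν ∧ ν {x | x + α x = 0}ᶜ = 0 ∧
      (∃ x, P.map ξ₁ = ν.map (fun z => z + x)) ∧ ∃ x, P.map ξ₂ = ν.map (fun z => z + x) := by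
  have : IsProbabilityMeasure (P.map ξ₁) := Measure.isProbabilityMeasure_map h₁.aemeasurable
  have : IsProbabilityMeasure (P.map ξ₂) := Measure.isProbabilityMeasure_map h₂.aemeasurable
  have hα : Measurable α := α.continuous_toFun.measurable
  -- The negative logarithms of the moduli solve the additive functional equation.
  have hone : ∀ (μ : Measure X) (y : CharacterGroup X), characteristicFn μ y ≠ 0 →
      -Real.log ‖characteristicFn μ y‖ = 0 → ‖characteristicFn μ y‖ = 1 := fun μ y hy h =>
    Real.eq_one_of_pos_of_log_eq_zero (norm_pos_iff.mpr hy) (neg_eq_zero.mp h)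
  have hvanish := eq_zero_of_heyde_equation (β := dualMap α)
    (φ := fun y => -Real.log ‖characteristicFn (P.map ξ₁) y.toMul‖)
    (ψ := fun y => -Real.log ‖characteristicFn (P.map ξ₂) y.toMul‖)
    (fun y => htor y.toMul) (dualMap_surjective α)
    (by simp [characteristicFn_one]) (by simp [characteristicFn_one])
    (fun y => neg_nonneg.mpr
      (Real.log_nonpos (norm_nonneg _) (norm_characteristicFn_le_one _ _)))
    (fun y => neg_nonneg.mpr
      (Real.log_nonpos (norm_nonneg _) (norm_characteristicFn_le_one _ _)))
    (fun y h hh => by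
      rw [toMul_add, norm_characteristicFn_mul_of_norm_eq_one _ (hone _ _ (hne₂ _) hh)])
    (fun u v => by
      have := congrArg (fun z : ℂ => Real.log ‖z‖)
        (characteristicFn_heyde_equation α h₁ h₂ hindep hsymm u v)
      simp only [norm_mul] at this
      rw [Real.log_mul (norm_ne_zero_iff.mpr (hne₁ _)) (norm_ne_zero_iff.mpr (hne₂ _)),
        Real.log_mul (norm_ne_zero_iff.mpr (hne₁ _)) (norm_ne_zero_iff.mpr (hne₂ _))] at this
      linarith)
  -- Both laws live on a coset of the kernel of `1 + α`.
  obtain ⟨x₁, hx₁⟩ := Measure.nonempty_support (IsProbabilityMeasure.ne_zero (P.map ξ₁))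
  obtain ⟨x₂, hx₂⟩ := Measure.nonempty_support (IsProbabilityMeasure.ne_zero (P.map ξ₂))
  have hker₁ : ∀ᵐ ω ∂P, ξ₁ ω - x₁ + α (ξ₁ ω - x₁) = 0 := by
    filter_upwards [ae_of_ae_map h₁.aemeasurable Measure.support_mem_ae] with ω hω
    exact add_map_sub_eq_zero_of_mem_support hsep
      (fun y => hone _ _ (hne₁ _) (hvanish y).1) hω hx₁
  have hker₂ : ∀ᵐ ω ∂P, ξ₂ ω - x₂ + α (ξ₂ ω - x₂) = 0 := by
    filter_upwards [ae_of_ae_map h₂.aemeasurable Measure.support_mem_ae] with ω hω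
    exact add_map_sub_eq_zero_of_mem_support hsep
      (fun y => hone _ _ (hne₂ _) (hvanish y).2) hω hx₂
  have hα₂ : ∀ᵐ ω ∂P, α (ξ₂ ω) = α x₂ - (ξ₂ ω - x₂) := by
    filter_upwards [hker₂] with ω hω
    rw [map_sub] at hω
    rw [eq_sub_iff_add_eq, ← sub_eq_zero, ← hω]
    abel
  -- On the kernel `α = -1`, so that, up to constants, `L₁ + L₂` is `2 ξ₁` and `L₁ - L₂` is `2 ξ₂`.
  have hlaw : P.map (fun ω => ξ₁ ω + ξ₂ ω + -(ξ₁ ω + α (ξ₂ ω))) =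
      P.map (fun ω => ξ₁ ω + ξ₂ ω + (ξ₁ ω + α (ξ₂ ω))) := by
    have := congrArg (Measure.map fun q : X × X => q.1 + q.2)
      (hsymm.map_prodMk_neg (h₁.add (hα.comp h₂)) (h₁.add h₂))
    rw [Measure.map_map (by fun_prop) (by fun_prop),
      Measure.map_map (by fun_prop) (by fun_prop)] at this
    exact this
  set c := x₂ + α x₂ with hc
  have hdiff : (fun ω => ξ₁ ω + ξ₂ ω + -(ξ₁ ω + α (ξ₂ ω))) =ᵐ[P]
      fun ω => ξ₂ ω + ξ₂ ω - c := by
    filter_upwards [hα₂] with ω hω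
    rw [hω, hc]
    abel
  have hsum : (fun ω => ξ₁ ω + ξ₂ ω + (ξ₁ ω + α (ξ₂ ω))) =ᵐ[P]
      fun ω => ξ₁ ω + ξ₁ ω + c := by
    filter_upwards [hα₂] with ω hω
    rw [hω, hc]
    abel
  rw [Measure.map_congr hdiff, Measure.map_congr hsum] at hlaw
  -- Cancel the doubling map, a closed embedding of the compact group `X`.
  have hemb : MeasurableEmbedding fun x : X => x + x - c := by
    refine (Continuous.isClosedEmbedding (by fun_prop) fun a b hab => ?_).measurableEmbedding
    have hab' : a + a = b + b := sub_left_injective hab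
    refine sub_eq_zero.mp (hdouble _ ?_)
    rw [show a - b + (a - b) = a + a - (b + b) by abel, hab', sub_self]
  have hmap₂ : P.map ξ₂ = P.map (fun ω => ξ₁ ω + c) := by
    refine hemb.map_injective ?_
    rw [Measure.map_map hemb.measurable h₂, Measure.map_map hemb.measurable (by fun_prop)]
    refine hlaw.trans (congrArg (fun f => P.map f) (funext fun ω => ?_))
    simp only [Function.comp_apply]
    abel
  refine ⟨P.map (fun ω => ξ₁ ω - x₁), Measure.isProbabilityMeasure_map (by fun_prop), ?_,
    ⟨x₁, ?_⟩, ⟨x₁ + c, ?_⟩⟩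
  · have hm : MeasurableSet {x : X | x + α x = 0} :=
      (isClosed_eq (continuous_id.add α.continuous_toFun) continuous_const).measurableSet
    rw [Measure.map_apply (by fun_prop) hm.compl]
    exact hker₁
  · rw [Measure.map_map (by fun_prop) (by fun_prop)]
    congr 1
    ext ω
    simp
  · rw [hmap₂, Measure.map_map (by fun_prop) (by fun_prop)]
    congr 1
    ext ω
    simp only [Function.comp_apply]
    abel

end Heyde

/-! ### Products of primary groups -/

section PrimaryFactor

variable {p : ℕ} [Fact p.Prime] {A : Type*} [AddCommGroup A] [TopologicalSpace A]

theorem PadicInt.continuous_toZModPow (n : ℕ) :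
    Continuous (PadicInt.toZModPow n : ℤ_[p] →+* ZMod (p ^ n)) := by
  refine continuous_of_continuousAt_zero (PadicInt.toZModPow n).toAddMonoidHom ?_
  rw [ContinuousAt, map_zero]
  refine (Filter.tendsto_pure.mpr ?_).mono_right (pure_le_nhds _)
  have hp : (0 : ℝ) < (p : ℝ) ^ (-n : ℤ) :=
    zpow_pos (by exact_mod_cast (Fact.out : p.Prime).pos) _
  filter_upwards [Metric.closedBall_mem_nhds (0 : ℤ_[p]) hp] with x hx
  rw [mem_closedBall_zero_iff, PadicInt.norm_le_pow_iff_mem_span_pow,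
    ← PadicInt.ker_toZModPow] at hx
  exact hx

/-- The kernels of continuous homomorphisms to the cyclic groups `ℤ/pᵏ` are arbitrarily small. -/
theorem IsPrimaryFactor.exists_continuous_hom_ker_subset (hA : IsPrimaryFactor p A) {U : Set A}
    (hU : U ∈ nhds 0) :
    ∃ (k : ℕ) (f : A →+ ZMod (p ^ k)), Continuous f ∧ ∀ x, f x = 0 → x ∈ U := by
  rcases hA with ⟨k, ⟨e⟩⟩ | ⟨⟨e⟩⟩
  · refine ⟨k, e.toAddMonoidHom, e.continuous_toFun, fun x hx => ?_⟩
    rw [(map_eq_zero_iff e e.injective).mp hx]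
    exact mem_of_mem_nhds hU
  · have hU' : e.symm ⁻¹' U ∈ nhds (0 : ℤ_[p]) :=
      e.symm.continuous_toFun.continuousAt.preimage_mem_nhds (by
        change U ∈ nhds (e.symm 0)
        rwa [map_zero])
    obtain ⟨ε, hε, hball⟩ := Metric.mem_nhds_iff.mp hU'
    obtain ⟨k, hk⟩ := PadicInt.exists_pow_neg_lt p hε
    refine ⟨k, (PadicInt.toZModPow k).toAddMonoidHom.comp e.toAddMonoidHom,
      (PadicInt.continuous_toZModPow k).comp e.continuous_toFun, fun x hx => ?_⟩
    have hx' : e x ∈ RingHom.ker (PadicInt.toZModPow k : ℤ_[p] →+* ZMod (p ^ k)) := hx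
    rw [PadicInt.ker_toZModPow, ← PadicInt.norm_le_pow_iff_mem_span_pow] at hx'
    have := hball (mem_ball_zero_iff.mpr (hx'.trans_lt hk))
    rwa [Set.mem_preimage, e.symm_apply_apply] at this

theorem IsPrimaryFactor.compactSpace (hA : IsPrimaryFactor p A) : CompactSpace A := by
  rcases hA with ⟨k, ⟨e⟩⟩ | ⟨⟨e⟩⟩
  · have : NeZero p := ⟨(Fact.out : p.Prime).ne_zero⟩
    exact e.toHomeomorph.symm.compactSpace
  · exact e.toHomeomorph.symm.compactSpace

theorem IsPrimaryFactor.t2Space (hA : IsPrimaryFactor p A) : T2Space A := by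
  rcases hA with ⟨k, ⟨e⟩⟩ | ⟨⟨e⟩⟩ <;> exact e.toHomeomorph.symm.t2Space

theorem IsPrimaryFactor.secondCountableTopology (hA : IsPrimaryFactor p A) :
    SecondCountableTopology A := by
  rcases hA with ⟨k, ⟨e⟩⟩ | ⟨⟨e⟩⟩
  · have : NeZero p := ⟨(Fact.out : p.Prime).ne_zero⟩
    exact e.toHomeomorph.secondCountableTopology
  · exact e.toHomeomorph.secondCountableTopology

theorem IsPrimaryFactor.eq_zero_of_add_self_eq_zero (hA : IsPrimaryFactor p A) (hp : p ≠ 2) {x : A}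
    (hx : x + x = 0) : x = 0 := by
  rcases hA with ⟨k, ⟨e⟩⟩ | ⟨⟨e⟩⟩
  · have h := congrArg e hx
    rw [map_add, map_zero,
      ZMod.add_self_eq_zero_iff_eq_zero (((Fact.out : p.Prime).odd_of_ne_two hp).pow)] at h
    exact (map_eq_zero_iff e e.injective).mp h
  · have h := congrArg e hx
    rw [map_add, map_zero, add_self_eq_zero] at h
    exact (map_eq_zero_iff e e.injective).mp h

end PrimaryFactor

section Product

variable {S : Set Nat.Primes} {A : S → Type*} [∀ p, AddCommGroup (A p)]
  [∀ p, TopologicalSpace (A p)] {X : Type*} [AddCommGroup X] [TopologicalSpace X]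

theorem exists_character_ne_one (hA : ∀ p : S, IsPrimaryFactor ((p : Nat.Primes) : ℕ) (A p))
    (e : X ≃ₜ+ (∀ p : S, A p)) {x : X} (hx : x ≠ 0) :
    ∃ y : CharacterGroup X, y (Multiplicative.ofAdd x) ≠ 1 := by
  obtain ⟨p, hp⟩ : ∃ p, e x p ≠ 0 := by
    by_contra! h
    exact hx ((map_eq_zero_iff e e.injective).mp (funext h))
  have := (hA p).t2Space
  obtain ⟨k, f, hf, hker⟩ :=
    (hA p).exists_continuous_hom_ker_subset (isOpen_compl_singleton.mem_nhds hp.symm)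
  have : NeZero ((p : Nat.Primes) : ℕ) := ⟨(p : Nat.Primes).2.ne_zero⟩
  let y : Multiplicative X →ₜ* Circle :=
    { toFun := fun z => ZMod.toCircle (f (e z.toAdd p))
      map_one' := by simp
      map_mul' := fun a b => by simp [AddChar.map_add_eq_mul]
      continuous_toFun := continuous_of_discreteTopology.comp (hf.comp
        ((continuous_apply p).comp (e.continuous_toFun.comp continuous_toAdd))) }
  refine ⟨y, fun hy => ?_⟩
  have hy' : ZMod.toCircle (f (e x p)) =
      ZMod.toCircle (0 : ZMod (((p : Nat.Primes) : ℕ) ^ k)) := by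
    rw [AddChar.map_zero_eq_one]
    exact hy
  exact hker _ (ZMod.injective_toCircle hy') rfl

/-- Every character of `X` has odd finite order. The circle has no small subgroups, so a character
is trivial on every subgroup inside a small neighbourhood of `0`; one such subgroup is cut out by
finitely many homomorphisms to cyclic groups `ℤ/pᵏ` with `p ∈ S`, and it contains `N X`, where `N`
is the product of the orders `pᵏ`. -/
theorem exists_odd_pow_eq_one (h2 : ∀ p ∈ S, (p : ℕ) ≠ 2)
    (hA : ∀ p : S, IsPrimaryFactor ((p : Nat.Primes) : ℕ) (A p))
    (e : X ≃ₜ+ (∀ p : S, A p)) (y : CharacterGroup X) : ∃ N : ℕ, Odd N ∧ y ^ N = 1 := by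
  let g : (∀ p : S, A p) → Circle := fun a => y (Multiplicative.ofAdd (e.symm a))
  have hg : Continuous g :=
    (map_continuous y).comp (continuous_ofAdd.comp e.symm.continuous_toFun)
  have hg0 : g 0 = 1 := by simp [g]
  have hg_nsmul : ∀ (n : ℕ) a, g (n • a) = g a ^ n := fun n a => by
    simp [g, map_nsmul, ofAdd_nsmul]
  have hU : g ⁻¹' Circle.centeredArc (Real.pi / 2) ∈ nhds (0 : ∀ p : S, A p) := by
    refine hg.continuousAt.preimage_mem_nhds ?_
    rw [hg0]
    refine (Circle.isOpen_centeredArc _).mem_nhds ?_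
    rw [Circle.mem_centeredArc (by linarith [Real.pi_pos])]
    simp [Real.pi_pos]
  rw [nhds_pi, Filter.mem_pi] at hU
  obtain ⟨F, hF, V, hV, hVU⟩ := hU
  choose k f hf hker using fun p => (hA p).exists_continuous_hom_ker_subset (hV p)
  refine ⟨∏ p ∈ hF.toFinset, ((p : Nat.Primes) : ℕ) ^ k p,
    Finset.prod_induction _ Odd (fun _ _ => Odd.mul) odd_one
      fun p _ => ((p : Nat.Primes).2.odd_of_ne_two (h2 p p.2)).pow, ?_⟩
  set N := ∏ p ∈ hF.toFinset, ((p : Nat.Primes) : ℕ) ^ k p with hN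
  refine PontryaginDual.ext fun x => ?_
  have key : g (N • e x.toAdd) = 1 := by
    refine Circle.eq_one_of_forall_pow_mem_centeredArc_pi_div_two fun n _ => ?_
    rw [← hg_nsmul]
    refine hVU fun p hp => hker p _ ?_
    obtain ⟨m, hm⟩ : ((p : Nat.Primes) : ℕ) ^ k p ∣ N :=
      Finset.dvd_prod_of_mem _ (hF.mem_toFinset.mpr hp)
    rw [Pi.smul_apply, Pi.smul_apply, map_nsmul, map_nsmul, nsmul_eq_mul (N : ℕ), hm,
      Nat.cast_mul, ZMod.natCast_self, zero_mul, zero_mul, smul_zero]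
  rw [hg_nsmul] at key
  have heval := map_pow (MonoidHom.mk' (fun z : CharacterGroup X => z x) fun _ _ => rfl) y N
  refine heval.trans ?_
  change y x ^ N = 1
  simpa [g] using key

end Product

theorem corollary2p9
    {S : Set Nat.Primes} (h2 : ∀ p ∈ S, (p : ℕ) ≠ 2)
    {A : S → Type*} [∀ p, AddCommGroup (A p)] [∀ p, TopologicalSpace (A p)]
    (hA : ∀ p : S, IsPrimaryFactor ((p : Nat.Primes) : ℕ) (A p))
    {X : Type*} [AddCommGroup X] [TopologicalSpace X] [IsTopologicalAddGroup X]
    [MeasurableSpace X] [BorelSpace X]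
    (hX : Nonempty (X ≃ₜ+ (∀ p : S, A p)))
    (α : X ≃ₜ+ X)
    {Ω : Type*} [MeasurableSpace Ω] (P : Measure Ω) [IsProbabilityMeasure P]
    (ξ : Fin 2 → Ω → X) (hξ : ∀ j, Measurable (ξ j)) (hindep : IndepFun (ξ 0) (ξ 1) P)
    (hsymm : HasSymmetricCondDistrib
      (fun ω => ξ 0 ω + α (ξ 1 ω)) (fun ω => ξ 0 ω + ξ 1 ω) P)
    (hne : ∀ j, ∀ y : CharacterGroup X, characteristicFn (P.map (ξ j)) y ≠ 0) :
    ∃ ν : Measure X, IsProbabilityMeasure ν ∧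
      ν (((AddMonoidHom.id X + (α : X →+ X)).ker : Set X)ᶜ) = 0 ∧
      ∀ j, ∃ x : X, P.map (ξ j) = ν.map (fun z => z + x) := by
  obtain ⟨e⟩ := hX
  have := fun p => (hA p).compactSpace
  have := fun p => (hA p).t2Space
  have := fun p => (hA p).secondCountableTopology
  have : CompactSpace X := e.toHomeomorph.symm.compactSpace
  have : T2Space X := e.toHomeomorph.symm.t2Space
  have : SecondCountableTopology X := e.toHomeomorph.secondCountableTopology
  have hdouble : ∀ x : X, x + x = 0 → x = 0 := fun x hx => by
    refine (map_eq_zero_iff e e.injective).mp (funext fun p => ?_)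
    refine (hA p).eq_zero_of_add_self_eq_zero (h2 p p.2) ?_
    rw [← Pi.add_apply, ← map_add, hx, map_zero, Pi.zero_apply]
  obtain ⟨ν, hν, hker, hshift₀, hshift₁⟩ := exists_common_shift_of_symmetric_condDistrib hdouble
    (fun x hx => exists_character_ne_one hA e hx) (exists_odd_pow_eq_one h2 hA e) α
    (hξ 0) (hξ 1) hindep hsymm (hne 0) (hne 1)
  exact ⟨ν, hν, hker, Fin.forall_fin_two.mpr ⟨hshift₀, hshift₁⟩⟩
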